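/- Let $V$ be a unital and integral quantale: a complete lattice with an associative tensor product $\otimes$ which distributes over arbitrary joins in each variable and has unit $k=\top\neq\bot$. Write $UX$ for the set of ultrafilters on a set $X$, $\dot x$ for the principal ultrafilter at $x$, $Uf(\mathfrak{x})$ for the image of an ultrafilter $\mathfrak x$ under a map $f$, and $\mu(\mathfrak{X})=\{A\subseteq X : \{\mathfrak{x}\in UX : A\in\mathfrak{x}\}\in\mathfrak{X}\}$ for the Kowalski sum of $\mathfrak{X}\in U^2X$. For sets $A,B$ and a map $r\colon A\times B\to V$, let $Ur\colon UA\times UB\to V$ be given by $$Ur(\mathfrak{a},\mathfrak{b})=\bigwedge_{S\in\mathfrak{a},\,T\in\mathfrak{b}}\ \bigvee_{a\in S,\,b\in T} r(a,b).$$ A $(U,V)$-category is a set $X$ with a map $c\colon UX\times X\to V$, written $X(\mathfrak{x},x)=c(\mathfrak x,x)$, such that, for all $x\in X$, $\mathfrak{x}\in UX$ and $\mathfrak{X}\in U^2X$, $$k\leq X(\dot x,x)\qquad\text{and}\qquad (Uc)(\mathfrak{X},\mathfrak{x})\otimes X(\mathfrak{x},x)\leq X(\mu(\mathfrak{X}),x).$$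 A $(U,V)$-functor $f\colon X\to Y$ is a map with $X(\mathfrak{x},x)\leq Y(Uf(\mathfrak{x}),f(x))$ for all $\mathfrak{x}\in UX$, $x\in X$. These form the category $(U,V)\text{-}\mathsf{Cat}$. Let $\mathcal{C}$ be a category and $Y$ an object of $\mathcal{C}$. $Y$ is a W-Mal'tsev object of $\mathcal C$ if, for every jointly monomorphic pair $r_1\colon R\to X$, $r_2\colon R\to Z$ in $\mathcal C$, the relation $\{(r_1t,r_2t) : t\in\mathcal{C}(Y,R)\}$ from $\mathcal{C}(Y,X)$ to $\mathcal{C}(Y,Z)$ is difunctional, where a relation $\rho$ is difunctional if $x_1\rho z_2$, $x_2\rho z_2$ and $x_2\rho z_1$ imply $x_1\rho z_1$. $Y$ is a Mal'tsev object of $\mathcal C$ if the category of points over $Y$ (split epimorphisms $A\to Y$ with a chosen splitting, and morphisms over $Y$ commuting with the splittings) is unital, that is, pointed and finitely complete, and such that for all objects $A,C$ the morphisms $\langle 1_A,0\rangle\colon A\to A\times C$ and $\langle 0,1_C\rangle\colon C\to A\times C$ are jointly strongly epimorphic. Then: 1. For every $(U,V)$-category $Y$ the following conditions are equivalent: (i)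 $Y$ is a W-Mal'tsev object in $((U,V)\text{-}\mathsf{Cat})^{\mathrm{op}}$; (ii) for all $\mathfrak{z}\in UY$ and $x,y\in Y$, (a) $Y(\mathfrak{z},x)\wedge Y(\mathfrak{z},y)\leq Y(\dot x,y)$, and (b) $Y(\mathfrak{z},x)\wedge Y(\dot x,y)\leq Y(\mathfrak{z},y)$. 2. If $V$ is not cartesian, i.e. $\otimes\neq\wedge$, then a $(U,V)$-category $Y$ is a Mal'tsev object in $((U,V)\text{-}\mathsf{Cat})^{\mathrm{op}}$ if and only if $Y=\emptyset$. -/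

import Mathlib

open CategoryTheory CategoryTheory.Limits Opposite

universe u v w

/-! ### Quantales -/

/-- A quantale `V = (V, ≤, ⊗, k)`, with `⊗` written `*`, is cartesian when its tensor product is
the binary meet. -/
def IsCartesianQuantale (V : Type v) [CompleteLattice V] [Monoid V] : Prop :=
  ∀ a b : V, a * b = a ⊓ b

/-! ### The ultrafilter monad and its extension to `V`-relations -/

/-- The multiplication `μ` of the ultrafilter monad (the Kowalski sum). -/
def kowalskiSum {X : Type u} (F : Ultrafilter (Ultrafilter X)) : Ultrafilter X :=
  F.bind id

theorem mem_kowalskiSum {X : Type u} {F : Ultrafilter (Ultrafilter X)} {A : Set X} :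
    A ∈ kowalskiSum F ↔ {f : Ultrafilter X | A ∈ f} ∈ F :=
  Iff.rfl

/-- The canonical extension of the ultrafilter functor `U` to `V`-relations: a `V`-relation
`r : X ⇸ Y` is sent to the `V`-relation `U r : U X ⇸ U Y` with
`U r (f, g) = ⋀_{A ∈ f, B ∈ g} ⋁_{x ∈ A, y ∈ B} r (x, y)`. -/
def ultraRel {V : Type v} [CompleteLattice V] {X : Type u} {Y : Type w} (r : X → Y → V)
    (f : Ultrafilter X) (g : Ultrafilter Y) : V :=
  ⨅ A ∈ f, ⨅ B ∈ g, ⨆ x ∈ A, ⨆ y ∈ B, r x y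

/-! ### The category of `(U,V)`-categories and `(U,V)`-functors -/

/-- A `(U,V)`-category: a set with a `V`-valued convergence structure `conv`, where `conv f x` is
what is usually written `X(f, x)`, that is reflexive and transitive. -/
structure UVCat (V : Type v) [CompleteLattice V] [Monoid V] : Type (max (u + 1) v) where
  /-- The underlying set. -/
  carrier : Type u
  /-- The structure map `U X × X → V`. -/
  conv : Ultrafilter carrier → carrier → V
  one_le_conv : ∀ x : carrier, 1 ≤ conv (pure x) x
  conv_trans : ∀ (F : Ultrafilter (Ultrafilter carrier)) (f : Ultrafilter carrier) (x : carrier),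
    ultraRel conv F f * conv f x ≤ conv (kowalskiSum F) x

namespace UVCat

/-- A `(U,V)`-functor. -/
@[ext]
structure Hom {V : Type v} [CompleteLattice V] [Monoid V] (X Y : UVCat.{u} V) : Type u where
  /-- The underlying map. -/
  toFun : X.carrier → Y.carrier
  conv_le : ∀ (f : Ultrafilter X.carrier) (x : X.carrier),
    X.conv f x ≤ Y.conv (f.map toFun) (toFun x)

instance instCategory {V : Type v} [CompleteLattice V] [Monoid V] : Category (UVCat.{u} V) where
  Hom X Y := Hom X Y
  id X := ⟨id, fun f x => by rw [Ultrafilter.map_id]; exact le_rfl⟩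
  comp p q := ⟨q.toFun ∘ p.toFun, fun f x => by
    rw [← Ultrafilter.map_map]
    exact (p.conv_le f x).trans (q.conv_le _ _)⟩

end UVCat

/-! ### W-Mal'tsev objects -/

/-- A set-theoretic binary relation is difunctional. -/
def Difunctional {A : Type u} {B : Type v} (r : A → B → Prop) : Prop :=
  ∀ (x₁ x₂ : A) (z₁ z₂ : B), r x₁ z₂ → r x₂ z₂ → r x₂ z₁ → r x₁ z₁

/-- The span `(r₁, r₂)` is jointly monomorphic, i.e. it is a relation from `X` to `Z`. -/
def JointlyMono {C : Type u} [Category.{v} C] {R X Z : C} (r₁ : R ⟶ X) (r₂ : R ⟶ Z) : Prop :=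
  ∀ (W : C) (f g : W ⟶ R), f ≫ r₁ = g ≫ r₁ → f ≫ r₂ = g ≫ r₂ → f = g

/-- `Y` is a W-Mal'tsev object of `C`: for every relation `X ← R → Z` in `C`, the induced relation
from `C(Y, X)` to `C(Y, Z)`, that is, the image of `C(Y, R)`, is difunctional. -/
def IsWMaltsevObject {C : Type u} [Category.{v} C] (Y : C) : Prop :=
  ∀ (R X Z : C) (r₁ : R ⟶ X) (r₂ : R ⟶ Z), JointlyMono r₁ r₂ →
    Difunctional (fun (x : Y ⟶ X) (z : Y ⟶ Z) => ∃ t : Y ⟶ R, t ≫ r₁ = x ∧ t ≫ r₂ = z)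

/-! ### Mal'tsev objects -/

/-- A point over `Y`: a split epimorphism onto `Y` with a chosen splitting. -/
structure Pt {C : Type u} [Category.{v} C] (Y : C) : Type (max u v) where
  /-- The domain of the split epimorphism. -/
  obj : C
  /-- The split epimorphism. -/
  proj : obj ⟶ Y
  /-- The chosen splitting. -/
  sec : Y ⟶ obj
  sec_proj : sec ≫ proj = 𝟙 Y

namespace Pt

/-- A morphism of points over `Y`. -/
@[ext]
structure Hom {C : Type u} [Category.{v} C] {Y : C} (A B : Pt Y) : Type v where
  /-- The underlying morphism. -/
  hom : A.obj ⟶ B.obj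
  hom_proj : hom ≫ B.proj = A.proj
  sec_hom : A.sec ≫ hom = B.sec

/-- The category of points of `C` over `Y`. -/
instance instCategory {C : Type u} [Category.{v} C] {Y : C} : Category (Pt Y) where
  Hom A B := Hom A B
  id A := ⟨𝟙 A.obj, Category.id_comp _, Category.comp_id _⟩
  comp p q := ⟨p.hom ≫ q.hom, by rw [Category.assoc, q.hom_proj, p.hom_proj], by
    rw [← Category.assoc, p.sec_hom, q.sec_hom]⟩
  id_comp p := Hom.ext (Category.id_comp p.hom)
  comp_id p := Hom.ext (Category.comp_id p.hom)
  assoc p q r := Hom.ext (Category.assoc p.hom q.hom r.hom)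

end Pt

/-- The pair `(i, j)` with common codomain is jointly strongly epimorphic: it is jointly
epimorphic and it has the left lifting property with respect to all monomorphisms. -/
structure JointlyStrongEpi {C : Type u} [Category.{v} C] {A B P : C} (i : A ⟶ P) (j : B ⟶ P) :
    Prop where
  jointly_epi : ∀ (Q : C) (f g : P ⟶ Q), i ≫ f = i ≫ g → j ≫ f = j ≫ g → f = g
  lift : ∀ (M N : C) (m : M ⟶ N) (a : A ⟶ M) (b : B ⟶ M) (p : P ⟶ N), Mono m →
    a ≫ m = i ≫ p → b ≫ m = j ≫ p → ∃ d : P ⟶ M, i ≫ d = a ∧ j ≫ d = b ∧ d ≫ m = p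

/-- A unital category: a pointed, finitely complete category such that for all objects `A` and `B`
the morphisms `⟨1, 0⟩ : A ⟶ A × B` and `⟨0, 1⟩ : B ⟶ A × B` are jointly strongly epimorphic. -/
structure IsUnitalCategory (C : Type u) [Category.{v} C] : Prop where
  hasZeroObject : HasZeroObject C
  hasFiniteLimits : HasFiniteLimits C
  jointlyStrongEpi : ∀ A B : C,
    letI : HasZeroMorphisms C := HasZeroObject.zeroMorphismsOfZeroObject
    JointlyStrongEpi (prod.lift (𝟙 A) (0 : A ⟶ B)) (prod.lift (0 : B ⟶ A) (𝟙 B))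

/-- `Y` is a Mal'tsev object of `C`: the category of points of `C` over `Y` is unital. -/
def IsMaltsevObject {C : Type u} [Category.{v} C] (Y : C) : Prop :=
  IsUnitalCategory (Pt Y)

/-!
Both parts rest on the initial structure of a `(U,V)`-category along a family of maps, computed as a
pointwise meet (`UVCat.initial`).

In the opposite category, a relation from `X` to `Z` is a pair of maps `X → R ← Z` which is jointly
surjective (`UVCat.jointly_surjective`; the test object is an indiscrete one), and `(x, z)` is in the
induced relation if the two maps `x` and `z` glue to a functor `R → Y`. If `t₁₂`, `t₂₂`, `t₂₁` are
functors `R → Y` with `t₁₂ = t₂₂` on the image of `Z` and `t₂₁ = t₂₂` on the image of `X`, then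
difunctionality asks that the map `t` which is `t₁₂` on the image of `X` and `t₂₁` on the image of
`Z` be a functor. An ultrafilter on `R` lives on one of the two images; when the ultrafilter and the
point are on the same side there is nothing to do, and otherwise `Y(a, p) ⊓ Y(b, p) ⊓ Y(b, q) ≤
Y(a, q)` is needed, which is exactly what (a) and (b) give. Conversely, (a) and (b) are read off from
`R = Y + 1` with the initial structure for three suitable maps `t₁₂`, `t₂₂`, `t₂₁`.

For the second part, a point over `Y` in the opposite category is a retract situation `Y → A → Y`,
and the product `Q` of the points `A` and `B` is the pushout of `A` and `B` under `Y`. That the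
injections into the product are jointly strongly epimorphic forces `Q` to carry the initial
structure for the two maps `Q → A`, `Q → B` (`conv_inf_le_conv_of_jointlyStrongEpi`). Let `A`, `B`, `P` be the
products of `Y` with the `V`-categories on three points `s`, `m`, `t` whose only nontrivial values
are, respectively, `s → m : a`; `m → t : b`; and `s → m : a`, `m → t : b`, `s → t : a * b`. Then `A`
and `B` map to `P`, so that `Q` does too. If `Y` is nonempty, the initial structure of `Q` has the
value `a ⊓ b` from `s` to `t`, hence `a ⊓ b ≤ a * b`, and `V` is cartesian.
-/

/-! ### Initial structures and finite `V`-categories -/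

namespace UVCat

theorem ultraRel_le_map {V : Type v} [CompleteLattice V] {X : Type u} {X' : Type w}
    {c : Ultrafilter X → X → V} {d : Ultrafilter X' → X' → V} (h : X → X')
    (hcd : ∀ f x, c f x ≤ d (f.map h) (h x)) (F : Ultrafilter (Ultrafilter X))
    (f : Ultrafilter X) :
    ultraRel c F f ≤ ultraRel d (F.map (Ultrafilter.map h)) (f.map h) := by
  refine le_iInf₂ fun S hS => le_iInf₂ fun T hT => ?_
  refine (iInf₂_le (Ultrafilter.map h ⁻¹' S) (Ultrafilter.mem_map.1 hS)).trans
    ((iInf₂_le (h ⁻¹' T) (Ultrafilter.mem_map.1 hT)).trans ?_)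
  refine iSup₂_le fun g hg => iSup₂_le fun x hx => (hcd g x).trans ?_
  exact le_iSup₂_of_le (g.map h) hg (le_iSup₂_of_le (h x) hx le_rfl)

theorem map_kowalskiSum {X : Type u} {X' : Type w} (h : X → X')
    (F : Ultrafilter (Ultrafilter X)) :
    (kowalskiSum F).map h = kowalskiSum (F.map (Ultrafilter.map h)) := by
  ext A
  simp [mem_kowalskiSum, Set.preimage]

theorem map_const_eq_pure {X : Type u} {X' : Type w} (f : Ultrafilter X) (x : X') :
    f.map (fun _ => x) = pure x := by
  refine Ultrafilter.coe_le_coe.1 ?_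
  exact Filter.tendsto_pure.2 (Filter.Eventually.of_forall fun _ => rfl)

theorem map_congr_of_eqOn {X : Type u} {X' : Type w} {f : Ultrafilter X} {S : Set X}
    (hS : S ∈ f) {p q : X → X'} (h : Set.EqOn p q S) : f.map p = f.map q := by
  ext A
  simp only [Ultrafilter.mem_map]
  constructor <;> intro hA <;> filter_upwards [hS, hA] with x hx hxA
  · rwa [Set.mem_preimage, ← h hx]
  · rwa [Set.mem_preimage, h hx]

variable {V : Type v} [CompleteLattice V] [Monoid V]

theorem unop_congr {X Y : (UVCat.{u} V)ᵒᵖ} {p q : X ⟶ Y} (h : p = q) (y : Y.unop.carrier) :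
    Hom.toFun p.unop y = Hom.toFun q.unop y := by
  rw [h]

/-- The initial `(U,V)`-structure on a set `X` along a family of maps to `(U,V)`-categories. -/
def initial [IsQuantale V] {X : Type u} {ι : Type w} (Y : ι → UVCat.{u} V)
    (h : ∀ i, X → (Y i).carrier) : UVCat.{u} V where
  carrier := X
  conv f x := ⨅ i, (Y i).conv (f.map (h i)) (h i x)
  one_le_conv x := le_iInf fun i => by
    rw [Ultrafilter.map_pure]
    exact (Y i).one_le_conv _
  conv_trans F f x := le_iInf fun i => by
    rw [map_kowalskiSum]
    refine le_trans ?_ ((Y i).conv_trans _ (f.map (h i)) _)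
    exact mul_le_mul' (ultraRel_le_map (h i) (fun _ _ => iInf_le _ i) F f) (iInf_le _ i)

/-- The `(U,V)`-category given by a `V`-category on a finite set, on which every ultrafilter is
principal. -/
noncomputable def ofFinite (X : Type u) [Finite X] (d : X → X → V) (hd : ∀ x, 1 ≤ d x x)
    (ht : ∀ x y z, d x y * d y z ≤ d x z) [IsQuantale V] : UVCat.{u} V where
  carrier := X
  conv f x := ⨆ y, ⨆ _ : f = pure y, d y x
  one_le_conv x := le_iSup₂_of_le x rfl (hd x)
  conv_trans F f x := by
    obtain ⟨y, rfl⟩ := f.eq_pure_of_finite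
    have : Finite (Ultrafilter X) :=
      Finite.of_surjective (pure : X → Ultrafilter X) fun g =>
        (g.eq_pure_of_finite).imp fun _ h => h.symm
    obtain ⟨g, rfl⟩ := F.eq_pure_of_finite
    obtain ⟨z, rfl⟩ := g.eq_pure_of_finite
    have e : kowalskiSum (pure (pure z)) = (pure z : Ultrafilter X) := rfl
    have key : ∀ z x : X, (⨆ y, ⨆ _ : (pure z : Ultrafilter X) = pure y, d y x) = d z x := by
      intro z x
      refine le_antisymm (iSup₂_le fun y h => ?_) (le_iSup₂_of_le z rfl le_rfl)
      rw [Ultrafilter.pure_injective h]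
    rw [e, key, key]
    refine le_trans (mul_le_mul_left ?_ _) (ht z y x)
    refine (iInf₂_le {pure z} (Ultrafilter.mem_pure.2 (Set.mem_singleton _))).trans ?_
    refine (iInf₂_le {y} (Ultrafilter.mem_pure.2 (Set.mem_singleton _))).trans ?_
    refine iSup₂_le fun g hg => iSup₂_le fun y' hy => ?_
    rw [Set.mem_singleton_iff.1 hg, Set.mem_singleton_iff.1 hy]
    exact (key z y).le

theorem ofFinite_conv_pure (X : Type u) [Finite X] (d : X → X → V) (hd : ∀ x, 1 ≤ d x x)
    (ht : ∀ x y z, d x y * d y z ≤ d x z) [IsQuantale V] (z x : X) :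
    (ofFinite X d hd ht).conv (pure z) x = d z x := by
  refine le_antisymm (iSup₂_le fun y h => ?_) (le_iSup₂_of_le z rfl le_rfl)
  rw [Ultrafilter.pure_injective h]

/-- The indiscrete `(U,V)`-category on a set. -/
def indiscrete (V : Type v) [CompleteLattice V] [Monoid V] (X : Type u) : UVCat.{u} V where
  carrier := X
  conv _ _ := ⊤
  one_le_conv _ := le_top
  conv_trans _ _ _ := le_top

end UVCat

open UVCat

variable {V : Type v} [CompleteLattice V] [Monoid V]

/-! ### W-Mal'tsev objects -/

theorem UVCat.jointly_surjective {R X Z : UVCat.{u} V} (r₁ : X ⟶ R) (r₂ : Z ⟶ R)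
    (h : JointlyMono r₁.op r₂.op) :
    Set.range (Hom.toFun r₁) ∪ Set.range (Hom.toFun r₂) = Set.univ := by
  classical
  set S := Set.range (Hom.toFun r₁) ∪ Set.range (Hom.toFun r₂) with hS
  let W : UVCat.{u} V := indiscrete V (ULift.{u} Prop)
  let p : R ⟶ W := ⟨fun x => ⟨x ∈ S⟩, fun _ _ => le_top⟩
  let q : R ⟶ W := ⟨fun _ => ⟨True⟩, fun _ _ => le_top⟩
  have hpq : p.op = q.op := by
    apply h (op W)
    · refine congrArg Quiver.Hom.op (Hom.ext (funext fun x => ?_))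
      exact congrArg ULift.up (eq_true (Or.inl ⟨x, rfl⟩))
    · refine congrArg Quiver.Hom.op (Hom.ext (funext fun x => ?_))
      exact congrArg ULift.up (eq_true (Or.inr ⟨x, rfl⟩))
  refine Set.eq_univ_of_forall fun x => ?_
  have := congrFun (congrArg Hom.toFun (Quiver.Hom.op_inj hpq)) x
  exact of_eq_true (congrArg ULift.down this)

/-- The gluing step: on an ultrafilter living on `S` and a point of `T`, the map which is `p` on `S`
and `q` on `T` preserves the structure, where `m` agrees with `q` on `S` and with `p` on `T`. -/
theorem UVCat.conv_le_of_eqOn {R Y : UVCat.{u} V}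
    (hY : ∀ (f : Ultrafilter Y.carrier) (x y : Y.carrier),
      Y.conv f x ⊓ Y.conv f y ≤ Y.conv (pure x) y ∧
      Y.conv f x ⊓ Y.conv (pure x) y ≤ Y.conv f y)
    (p m q : Hom R Y) {S T : Set R.carrier} (hS : Set.EqOn m.toFun q.toFun S)
    (hT : Set.EqOn p.toFun m.toFun T) {f : Ultrafilter R.carrier} (hf : S ∈ f) {x : R.carrier}
    (hx : x ∈ T) : R.conv f x ≤ Y.conv (f.map p.toFun) (q.toFun x) := by
  have h1 := p.conv_le f x
  have h2 := m.conv_le f x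
  have h3 := q.conv_le f x
  rw [hT hx] at h1
  rw [map_congr_of_eqOn hf hS] at h2
  exact (le_inf h1 ((le_inf h2 h3).trans (hY _ _ _).1)).trans (hY _ _ _).2

theorem isWMaltsevObject_of_conv {Y : UVCat.{u} V}
    (hY : ∀ (f : Ultrafilter Y.carrier) (x y : Y.carrier),
      Y.conv f x ⊓ Y.conv f y ≤ Y.conv (pure x) y ∧
      Y.conv f x ⊓ Y.conv (pure x) y ≤ Y.conv f y) :
    IsWMaltsevObject (op Y) := by
  classical
  rintro R X Z r₁ r₂ hr x₁ x₂ z₁ z₂ ⟨t₁₂, h12, h12'⟩ ⟨t₂₂, h22, h22'⟩ ⟨t₂₁, h21, h21'⟩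
  have hsurj := jointly_surjective r₁.unop r₂.unop hr
  let p : Hom R.unop Y := t₁₂.unop
  let m : Hom R.unop Y := t₂₂.unop
  let q : Hom R.unop Y := t₂₁.unop
  let S := Set.range (Hom.toFun r₁.unop)
  let T := Set.range (Hom.toFun r₂.unop)
  have hS : Set.EqOn m.toFun q.toFun S := by
    rintro _ ⟨x, rfl⟩
    exact unop_congr (h22.trans h21.symm) x
  have hT : Set.EqOn p.toFun m.toFun T := by
    rintro _ ⟨x, rfl⟩
    exact unop_congr (h12'.trans h22'.symm) x
  let t : R.unop.carrier → Y.carrier := fun x => if x ∈ S then p.toFun x else q.toFun x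
  have tS : Set.EqOn t p.toFun S := fun x hx => if_pos hx
  have tT : Set.EqOn t q.toFun T := fun x hx => by
    by_cases h : x ∈ S
    · exact (if_pos h).trans ((hT hx).trans (hS h))
    · exact if_neg h
  have ht : ∀ f x, R.unop.conv f x ≤ Y.conv (f.map t) (t x) := by
    intro f x
    have hx : x ∈ S ∪ T := hsurj ▸ Set.mem_univ x
    have hf : S ∪ T ∈ f := by
      rw [show S ∪ T = Set.univ from hsurj]
      exact Filter.univ_mem
    rcases Ultrafilter.union_mem_iff.1 hf with hf | hf <;> rcases hx with hx | hx
    · rw [map_congr_of_eqOn hf tS, tS hx]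
      exact p.conv_le f x
    · rw [map_congr_of_eqOn hf tS, tT hx]
      exact conv_le_of_eqOn hY p m q hS hT hf hx
    · rw [map_congr_of_eqOn hf tT, tS hx]
      exact conv_le_of_eqOn hY q m p hT.symm hS.symm hf hx
    · rw [map_congr_of_eqOn hf tT, tT hx]
      exact q.conv_le f x
  let t' : R.unop ⟶ Y := ⟨t, ht⟩
  refine ⟨t'.op, ?_, ?_⟩
  · rw [← h12]
    exact congrArg Quiver.Hom.op (Hom.ext (funext fun x => tS ⟨x, rfl⟩))
  · rw [← h21']
    exact congrArg Quiver.Hom.op (Hom.ext (funext fun x => tT ⟨x, rfl⟩))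

/-- Difunctionality for the relation on `Y + 1` given by its two summands, with the initial
structure for the three maps `(α, x)`, `(β, x)`, `(β, y)` to `Y`: the map `(α, y)` is then a
functor as well. -/
theorem IsWMaltsevObject.conv_le [IsQuantale V] {Y : UVCat.{u} V} (h : IsWMaltsevObject (op Y))
    (α β : Y.carrier → Y.carrier) (f : Ultrafilter Y.carrier) (x y : Y.carrier) :
    Y.conv (f.map α) x ⊓ Y.conv (f.map β) x ⊓ Y.conv (f.map β) y ≤ Y.conv (f.map α) y := by
  let e (γ : Y.carrier → Y.carrier) (w : Y.carrier) : Option Y.carrier → Y.carrier :=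
    fun o => o.elim w γ
  let k : Fin 3 → Option Y.carrier → Y.carrier := ![e α x, e β x, e β y]
  let R : UVCat.{u} V := initial (fun _ : Fin 3 => Y) k
  let X : UVCat.{u} V := initial (fun _ : Unit => R) (fun _ => (some : Y.carrier → R.carrier))
  let Z : UVCat.{u} V := initial (fun _ : Unit => R)
    (fun _ => (fun _ => none : PUnit.{u + 1} → R.carrier))
  let r₁ : X ⟶ R := ⟨some, fun _ _ => iInf_le _ ()⟩
  let r₂ : Z ⟶ R := ⟨fun _ => none, fun _ _ => iInf_le _ ()⟩
  have hr : JointlyMono r₁.op r₂.op := by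
    intro W p q hp hq
    apply Quiver.Hom.unop_inj
    refine Hom.ext (funext fun o => ?_)
    cases o with
    | none => exact unop_congr hq PUnit.unit
    | some a => exact unop_congr hp a
  let t (i : Fin 3) : R ⟶ Y := ⟨k i, fun _ _ => iInf_le _ i⟩
  obtain ⟨s, hs₁, hs₂⟩ := h _ _ _ r₁.op r₂.op hr (r₁ ≫ t 0).op (r₁ ≫ t 1).op (r₂ ≫ t 2).op
    (r₂ ≫ t 0).op ⟨(t 0).op, rfl, rfl⟩ ⟨(t 1).op, rfl, rfl⟩ ⟨(t 2).op, rfl, rfl⟩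
  have hs : Hom.toFun s.unop = e α y := by
    funext o
    cases o with
    | none => exact unop_congr hs₂ PUnit.unit
    | some a => exact unop_congr hs₁ a
  have key := Hom.conv_le s.unop (f.map some) none
  rw [hs] at key
  refine le_trans (le_iInf fun i => ?_) key
  fin_cases i
  · exact inf_le_left.trans inf_le_left
  · exact inf_le_left.trans inf_le_right
  · exact inf_le_right

theorem isWMaltsevObject_iff [IsQuantale V] (integral : (1 : V) = ⊤) (Y : UVCat.{u} V) :
    IsWMaltsevObject (op Y) ↔
      ∀ (f : Ultrafilter Y.carrier) (x y : Y.carrier),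
        Y.conv f x ⊓ Y.conv f y ≤ Y.conv (pure x) y ∧
        Y.conv f x ⊓ Y.conv (pure x) y ≤ Y.conv f y := by
  refine ⟨fun h f x y => ?_, isWMaltsevObject_of_conv⟩
  have hx : Y.conv (pure x) x = ⊤ := top_le_iff.1 (integral ▸ Y.one_le_conv x)
  -- The constant map at `x` replaces `f` by the principal ultrafilter at `x`.
  constructor
  · simpa [map_const_eq_pure, hx] using h.conv_le (fun _ => x) id f x y
  · simpa [map_const_eq_pure, hx] using h.conv_le id (fun _ => x) f x y

/-! ### Mal'tsev objects -/

theorem isMaltsevObject_of_isEmpty (Y : UVCat.{u} V) [hY : IsEmpty Y.carrier] :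
    IsMaltsevObject (op Y) := by
  have hE (A : Pt (op Y)) : IsEmpty A.obj.unop.carrier :=
    ⟨fun a => hY.elim (Hom.toFun A.sec.unop a)⟩
  have hsub (A B : Pt (op Y)) (p q : A ⟶ B) : p = q :=
    Pt.Hom.ext (Quiver.Hom.unop_inj (Hom.ext (funext fun b => ((hE B).elim b))))
  -- All points have an empty underlying set, so that there is exactly one morphism between any two.
  let m (A B : Pt (op Y)) : A ⟶ B :=
    ⟨Quiver.Hom.op ⟨fun b => (hE B).elim b, fun _ x => (hE B).elim x⟩,
      Quiver.Hom.unop_inj (Hom.ext (funext fun b => hY.elim b)),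
      Quiver.Hom.unop_inj (Hom.ext (funext fun b => (hE B).elim b))⟩
  let O : Pt (op Y) := ⟨op Y, 𝟙 _, 𝟙 _, Category.id_comp _⟩
  refine ⟨⟨O, fun A => ⟨⟨⟨m O A⟩, fun _ => hsub _ _ _ _⟩⟩,
      fun A => ⟨⟨⟨m A O⟩, fun _ => hsub _ _ _ _⟩⟩⟩,
    ⟨fun J _ _ => ⟨fun F => ⟨⟨⟨⟨O, ⟨fun j => m _ _, fun _ _ _ => hsub _ _ _ _⟩⟩,
      ⟨fun s => m _ _, fun _ _ => hsub _ _ _ _, fun _ _ _ => hsub _ _ _ _⟩⟩⟩⟩⟩⟩, fun A B => ?_⟩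
  exact ⟨fun _ _ _ _ _ => hsub _ _ _ _,
    fun M N _ _ _ _ _ _ _ => ⟨m _ _, hsub _ _ _ _, hsub _ _ _ _, hsub _ _ _ _⟩⟩

/-- The zero morphism factors through the zero object of the category of points, which is `Y`
itself. -/
theorem Pt.zero_hom {C : Type u} [Category.{v} C] {Y : C} [HasZeroMorphisms (Pt Y)] (A B : Pt Y) :
    Pt.Hom.hom (0 : A ⟶ B) = A.proj ≫ B.sec := by
  let O : Pt Y := ⟨Y, 𝟙 _, 𝟙 _, Category.id_comp _⟩
  let p : A ⟶ O := ⟨A.proj, Category.comp_id _, A.sec_proj⟩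
  have h : Pt.Hom.hom (0 : O ⟶ B) = B.sec :=
    (Category.id_comp _).symm.trans (Pt.Hom.sec_hom (0 : O ⟶ B))
  rw [← comp_zero (f := p), ← h]
  rfl

/-- If `i` and `j` are jointly strongly epimorphic morphisms of points over `Y` in the opposite
category, then their codomain `Q` carries the initial structure for the underlying maps `Q → A` and
`Q → B`. -/
theorem conv_inf_le_conv_of_jointlyStrongEpi [IsQuantale V] {Y : UVCat.{u} V}
    {A B Q : Pt (op Y)} (i : A ⟶ Q) (j : B ⟶ Q) (h : JointlyStrongEpi i j) (f : Ultrafilter Q.obj.unop.carrier)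
    (x : Q.obj.unop.carrier) :
    A.obj.unop.conv (f.map (Hom.toFun i.hom.unop)) (Hom.toFun i.hom.unop x) ⊓
      B.obj.unop.conv (f.map (Hom.toFun j.hom.unop)) (Hom.toFun j.hom.unop x) ≤
        Q.obj.unop.conv f x := by
  -- The identity from `Q` to `Q` with the initial structure is a monomorphism of points in the
  -- opposite category, and a lift of `𝟙 Q` along it is an inverse.
  let M₀ : UVCat.{u} V := initial (X := Q.obj.unop.carrier)
    (fun b : Bool => b.rec A.obj.unop B.obj.unop)
    (fun b => b.rec (Hom.toFun i.hom.unop) (Hom.toFun j.hom.unop))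
  let m₀ : Q.obj.unop ⟶ M₀ := ⟨id, fun f x => le_iInf fun b => by
    cases b
    · exact Hom.conv_le i.hom.unop f x
    · exact Hom.conv_le j.hom.unop f x⟩
  let a₀ : M₀ ⟶ A.obj.unop := ⟨Hom.toFun (X := Q.obj.unop) i.hom.unop, fun _ _ => iInf_le _ false⟩
  let b₀ : M₀ ⟶ B.obj.unop := ⟨Hom.toFun (X := Q.obj.unop) j.hom.unop, fun _ _ => iInf_le _ true⟩
  have hs : a₀ ≫ A.sec.unop = b₀ ≫ B.sec.unop :=
    Hom.ext (funext fun x => unop_congr (i.sec_hom.trans j.sec_hom.symm) x)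
  have hi : m₀ ≫ a₀ ≫ A.sec.unop = Q.sec.unop := congrArg Quiver.Hom.unop i.sec_hom
  let M : Pt (op Y) := ⟨op M₀, (Q.proj.unop ≫ m₀).op, (a₀ ≫ A.sec.unop).op, by
    apply Quiver.Hom.unop_inj
    change (Q.proj.unop ≫ m₀) ≫ a₀ ≫ A.sec.unop = 𝟙 _
    rw [Category.assoc, hi]
    exact congrArg Quiver.Hom.unop Q.sec_proj⟩
  let m : M ⟶ Q := ⟨m₀.op, rfl, congrArg Quiver.Hom.op hi⟩
  let a : A ⟶ M := ⟨a₀.op, i.hom_proj, rfl⟩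
  let b : B ⟶ M := ⟨b₀.op, j.hom_proj, congrArg Quiver.Hom.op hs.symm⟩
  have hm : Mono m := ⟨fun {N} p q hpq => by
    apply Pt.Hom.ext
    apply Quiver.Hom.unop_inj
    exact Hom.ext (congrArg (fun k => Hom.toFun (Quiver.Hom.unop (Pt.Hom.hom k))) hpq)⟩
  obtain ⟨d, -, -, hd⟩ := h.lift M Q m a b (𝟙 Q) hm rfl rfl
  have hid : Hom.toFun d.hom.unop = id :=
    congrArg (fun k => Hom.toFun (Quiver.Hom.unop (Pt.Hom.hom k))) hd
  have key := Hom.conv_le d.hom.unop f x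
  rw [hid] at key
  refine le_trans (le_iInf fun b => ?_) key
  cases b
  · exact inf_le_left
  · exact inf_le_right

/-- A set with three elements. -/
inductive ThreePoints : Type u
  | source
  | middle
  | target

namespace ThreePoints

instance : Finite ThreePoints.{u} :=
  Finite.of_surjective (fun i : Fin 3 => (![source, middle, target] : Fin 3 → ThreePoints) i)
    fun x => by
      cases x
      · exact ⟨0, rfl⟩
      · exact ⟨1, rfl⟩
      · exact ⟨2, rfl⟩

/-- The `V`-graph on three points with edges `a : source → middle`, `b : middle → target` and
`c : source → target`, with loops `⊤` and all other values `⊥`. -/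
def value (a b c : V) : ThreePoints.{u} → ThreePoints.{u} → V
  | source, middle => a
  | middle, target => b
  | source, target => c
  | source, source => ⊤
  | middle, middle => ⊤
  | target, target => ⊤
  | _, _ => ⊥

theorem value_mul_le [IsQuantale V] (integral : (1 : V) = ⊤) {a b c : V} (h : a * b ≤ c)
    (x y z : ThreePoints.{u}) : value a b c x y * value a b c y z ≤ value a b c x z := by
  cases x <;> cases y <;> cases z <;> simp [value, ← integral, h]

end ThreePoints

open ThreePoints

/-- The `(U,V)`-category on three points with edges `a`, `b`, `c`. -/
noncomputable def UVCat.three [IsQuantale V] (integral : (1 : V) = ⊤) (a b c : V)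
    (h : a * b ≤ c) : UVCat.{u} V :=
  ofFinite ThreePoints.{u} (value a b c) (fun x => by cases x <;> exact le_top)
    (value_mul_le integral h)

/-- The product of `Y` with the `(U,V)`-category on three points with edges `a`, `b`, `c`. -/
noncomputable def UVCat.prodThree [IsQuantale V] (integral : (1 : V) = ⊤) (Y : UVCat.{u} V)
    (a b c : V) (h : a * b ≤ c) : UVCat.{u} V :=
  initial (X := Y.carrier × ThreePoints.{u})
    (fun i : Bool => i.rec Y (three integral a b c h))
    (fun i => i.rec Prod.fst Prod.snd)

section prodThree

variable [IsQuantale V] (integral : (1 : V) = ⊤) (Y : UVCat.{u} V)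

theorem UVCat.prodThree_conv_pure {a b c : V} (h : a * b ≤ c) (y : Y.carrier)
    (s t : ThreePoints.{u}) :
    (prodThree integral Y a b c h).conv (pure (y, s)) (y, t) = value a b c s t := by
  have hy : Y.conv (pure y) y = ⊤ := top_le_iff.1 (integral ▸ Y.one_le_conv y)
  refine iInf_bool_eq.trans ?_
  change (ofFinite _ _ _ _).conv (Ultrafilter.map Prod.snd (pure (y, s))) t ⊓
    Y.conv (Ultrafilter.map Prod.fst (pure (y, s))) y = _
  rw [Ultrafilter.map_pure, Ultrafilter.map_pure, ofFinite_conv_pure, hy, inf_top_eq]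

/-- The point over `Y` in the opposite category given by the section `y ↦ (y, middle)` of the
projection from the product of `Y` with a three-point category. -/
noncomputable def Pt.prodThree (a b c : V) (h : a * b ≤ c) : Pt (op Y) where
  obj := op (UVCat.prodThree integral Y a b c h)
  proj := Quiver.Hom.op ⟨fun y => (y, middle), fun f x => le_iInf fun i => by
    cases i
    · exact le_rfl
    · let T : UVCat.{u} V := three integral a b c h
      let t : T.carrier := middle
      change _ ≤ T.conv (f.map fun _ => t) t
      rw [map_const_eq_pure]
      exact le_top.trans (integral.ge.trans (T.one_le_conv t))⟩
  sec := Quiver.Hom.op ⟨Prod.fst, fun _ _ => iInf_le _ false⟩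
  sec_proj := rfl

/-- Enlarging the values on the edges gives a functor under and over `Y`. -/
noncomputable def Pt.prodThreeMap {a b c a' b' c' : V} (h : a * b ≤ c) (h' : a' * b' ≤ c')
    (ha : a ≤ a') (hb : b ≤ b') (hc : c ≤ c') :
    Pt.prodThree integral Y a' b' c' h' ⟶ Pt.prodThree integral Y a b c h where
  hom := Quiver.Hom.op ⟨id, fun f x => by
    refine iInf_mono fun i => ?_
    cases i
    · exact le_rfl
    · refine iSup₂_mono fun y _ => ?_
      change value a b c y x.2 ≤ value a' b' c' y x.2
      generalize x.2 = z
      cases y <;> cases z <;> simp [value, ha, hb, hc]⟩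
  hom_proj := rfl
  sec_hom := rfl

end prodThree

theorem IsMaltsevObject.inf_le_mul [IsQuantale V] (integral : (1 : V) = ⊤) {Y : UVCat.{u} V}
    (hY : IsMaltsevObject (op Y)) (y : Y.carrier) (a b : V) : a ⊓ b ≤ a * b := by
  let := hY.hasZeroObject
  let := hY.hasFiniteLimits
  let : HasZeroMorphisms (Pt (op Y)) := HasZeroObject.zeroMorphismsOfZeroObject
  let A := Pt.prodThree integral Y a ⊥ ⊥ (by simp)
  let B := Pt.prodThree integral Y ⊥ b ⊥ (by simp)
  let P := Pt.prodThree integral Y a b (a * b) le_rfl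
  let α : P ⟶ A := Pt.prodThreeMap integral Y _ _ le_rfl bot_le bot_le
  let β : P ⟶ B := Pt.prodThreeMap integral Y _ _ bot_le le_rfl bot_le
  let Q := A ⨯ B
  let l : P ⟶ Q := prod.lift α β
  let i : A ⟶ Q := prod.lift (𝟙 A) 0
  let j : B ⟶ Q := prod.lift 0 (𝟙 B)
  have h : JointlyStrongEpi i j := hY.jointlyStrongEpi A B
  let φ {E F : Pt (op Y)} (p : E ⟶ F) : F.obj.unop.carrier → E.obj.unop.carrier :=
    Hom.toFun p.hom.unop
  have hcomp {E F G : Pt (op Y)} (p : E ⟶ F) (q : F ⟶ G) (r : E ⟶ G) (e : p ≫ q = r)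
      (x : G.obj.unop.carrier) : φ p (φ q x) = φ r x := by rw [← e]; rfl
  -- In the pushout `Q`, `s` and `t` are the images of the source in `A` and of the target in `B`.
  let s : Q.obj.unop.carrier := φ (prod.fst : Q ⟶ A) (y, source)
  let t : Q.obj.unop.carrier := φ (prod.snd : Q ⟶ B) (y, target)
  have hzero {E F : Pt (op Y)} (x : F.obj.unop.carrier) :
      φ (0 : E ⟶ F) x = Hom.toFun E.proj.unop (Hom.toFun F.sec.unop x) := by
    change Hom.toFun (Pt.Hom.hom (0 : E ⟶ F)).unop x = _
    rw [Pt.zero_hom]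
    rfl
  have his : φ i s = (y, source) := hcomp i prod.fst (𝟙 A) (prod.lift_fst _ _) _
  have hit : φ i t = (y, middle) := (hcomp i prod.snd 0 (prod.lift_snd _ _) _).trans (hzero _)
  have hjs : φ j s = (y, middle) := (hcomp j prod.fst 0 (prod.lift_fst _ _) _).trans (hzero _)
  have hjt : φ j t = (y, target) := hcomp j prod.snd (𝟙 B) (prod.lift_snd _ _) _
  have hls : φ l s = (y, source) := hcomp l prod.fst α (prod.lift_fst _ _) _
  have hlt : φ l t = (y, target) := hcomp l prod.snd β (prod.lift_snd _ _) _
  have key := (conv_inf_le_conv_of_jointlyStrongEpi i j h (pure s) t).trans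
    (Hom.conv_le l.hom.unop (pure s) t)
  change A.obj.unop.conv ((pure s : Ultrafilter _).map (φ i)) (φ i t) ⊓
    B.obj.unop.conv ((pure s : Ultrafilter _).map (φ j)) (φ j t) ≤
    P.obj.unop.conv ((pure s : Ultrafilter _).map (φ l)) (φ l t) at key
  rw [Ultrafilter.map_pure, Ultrafilter.map_pure, Ultrafilter.map_pure,
    his, hit, hjs, hjt, hls, hlt] at key
  have hA : A.obj.unop.conv (pure (y, source)) (y, middle) = a :=
    prodThree_conv_pure integral Y (by simp) y source middle
  have hB : B.obj.unop.conv (pure (y, middle)) (y, target) = b :=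
    prodThree_conv_pure integral Y (by simp) y middle target
  have hP : P.obj.unop.conv (pure (y, source)) (y, target) = a * b :=
    prodThree_conv_pure integral Y le_rfl y source target
  exact ((inf_le_inf hA.ge hB.ge).trans key).trans hP.le

theorem isCartesianQuantale_of_inf_le_mul [IsQuantale V] (integral : (1 : V) = ⊤)
    (h : ∀ a b : V, a ⊓ b ≤ a * b) : IsCartesianQuantale V := fun a b =>
  le_antisymm (le_inf (mul_le_of_le_one_right' (integral ▸ le_top))
    (mul_le_of_le_one_left' (integral ▸ le_top))) (h a b)

theorem mainTheorem3 {V : Type v} [CompleteLattice V] [Monoid V] [IsQuantale V] [Nontrivial V]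
    (integral : (1 : V) = ⊤) :
    (∀ Y : UVCat.{u} V,
      IsWMaltsevObject (op Y) ↔
        ∀ (f : Ultrafilter Y.carrier) (x y : Y.carrier),
          Y.conv f x ⊓ Y.conv f y ≤ Y.conv (pure x) y ∧
          Y.conv f x ⊓ Y.conv (pure x) y ≤ Y.conv f y) ∧
    (¬ IsCartesianQuantale V →
      ∀ Y : UVCat.{u} V, IsMaltsevObject (op Y) ↔ IsEmpty Y.carrier) := by
  refine ⟨isWMaltsevObject_iff integral, fun hV Y => ⟨fun hY => ⟨fun y => hV ?_⟩, fun _ =>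
    isMaltsevObject_of_isEmpty Y⟩⟩
  exact isCartesianQuantale_of_inf_le_mul integral (hY.inf_le_mul integral y)
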